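/- Let $d\in\mathbb{N}$, $T\ge 0$. Let $f:[0,T]\times\mathbb{R}^d\to\mathbb{R}^d$ be continuous, and let $l_f:[0,T]\to\mathbb{R}$ be continuous such that $\langle f(t,x)-f(t,x'),x-x'\rangle\le l_f(t)|x-x'|^2$ for all $t\in[0,T]$ and $x,x'\in\mathbb{R}^d$, where $|\cdot|$ is the Euclidean norm. Let $M$ map $[0,T]\times\mathbb{R}^d$ into the nonempty convex compact subsets of $\mathbb{R}^d$, continuously with respect to the Hausdorff distance, and suppose there is a continuous $L_M:[0,T]\to[0,\infty)$ such that $x\mapsto M(t,x)$ is $L_M(t)$-Lipschitz with respect to the Hausdorff distance for every $t\in[0,T]$. For sets $A,B\subset\mathbb{R}^d$ that are nonempty and compact put $\operatorname{dist}(A,B)=\sup_{a\in A}\inf_{b\in B}|a-b|$, and identify a point $y$ with $\{y\}$. Let $t\in[0,T]$, $x\in\mathbb{R}^d$ and $h\ge 0$ satisfy $t+h\le T$ and $l_f(t+h)h<1$, and let $$\Phi(t,x;h)=\{z\in\mathbb{R}^d:\ z\in x+hf(t+h,z)+hM(t,x)\}.$$ Then $\Phi(t,x;h)$ is nonempty and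 compact, $$\operatorname{diam}\Phi(t,x;h)\le\frac{h}{1-l_f(t+h)h}\,\operatorname{diam}M(t,x),$$ and for every $y\in\mathbb{R}^d$ $$\operatorname{dist}(y,\Phi(t,x;h))\le\frac{1}{1-l_f(t+h)h}\operatorname{dist}\bigl(y,\,x+hf(t+h,y)+hM(t,x)\bigr),$$ $$\operatorname{dist}(\Phi(t,x;h),y)\le\frac{1}{1-l_f(t+h)h}\operatorname{dist}\bigl(x+hf(t+h,y)+hM(t,x),\,y\bigr).$$ -/

import Mathlib

/-- The space `ℝ^d` with its Euclidean norm and inner product. -/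
abbrev RSpace (d : ℕ) : Type := EuclideanSpace ℝ (Fin d)

/-- One-sided Hausdorff distance `sup_{a ∈ A} inf_{b ∈ B} |a - b|`
(meant for nonempty compact sets `A`, `B`, for which the infima and the supremum are finite;
a point `y` is identified with the set `{y}`). -/
noncomputable def osDist {d : ℕ} (A B : Set (RSpace d)) : ℝ :=
  ⨆ a : A, Metric.infDist (a : RSpace d) B

/-- A map `g : ℝ^d → ℝ^d` is one-sided Lipschitz with constant `l` (possibly negative). -/
def IsOSL {d : ℕ} (l : ℝ) (g : RSpace d → RSpace d) : Prop :=
  ∀ x x' : RSpace d, inner ℝ (g x - g x') (x - x') ≤ l * ‖x - x'‖ ^ 2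

/-- Assumptions on the single-valued part `f : [0,T] × ℝ^d → ℝ^d` and on `lf : [0,T] → ℝ`.
Only the values at times in `[0,T]` matter.
(A continuous function on the compact interval `[0,T]` is integrable.) -/
structure SinglePart {d : ℕ} (T : ℝ) (f : ℝ → RSpace d → RSpace d) (lf : ℝ → ℝ) : Prop where
  continuousOn : ContinuousOn (fun p : ℝ × RSpace d => f p.1 p.2) (Set.Icc 0 T ×ˢ Set.univ)
  continuousOn_lf : ContinuousOn lf (Set.Icc 0 T)
  isOSL : ∀ t ∈ Set.Icc 0 T, IsOSL (lf t) (f t)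

/-- Assumptions on the set-valued part `M`, whose values are nonempty convex compact subsets of
`ℝ^d`. The distance and the topology on `ConvexBody` are those of the Hausdorff metric.
Only the values at times in `[0,T]` matter. -/
structure MultiPart {d : ℕ} (T : ℝ) (M : ℝ → RSpace d → ConvexBody (RSpace d)) : Prop where
  continuousOn : ContinuousOn (fun p : ℝ × RSpace d => M p.1 p.2) (Set.Icc 0 T ×ˢ Set.univ)
  lipschitz : ∃ LM : ℝ → ℝ, ContinuousOn LM (Set.Icc 0 T) ∧
    ∀ t ∈ Set.Icc 0 T, 0 ≤ LM t ∧
      ∀ x x' : RSpace d, dist (M t x) (M t x') ≤ LM t * ‖x - x'‖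

/-- The set `x + h f(t+h, z) + h M(t, x)`. -/
def stepSet {d : ℕ} (f : ℝ → RSpace d → RSpace d) (M : ℝ → RSpace d → ConvexBody (RSpace d))
    (t : ℝ) (x : RSpace d) (h : ℝ) (z : RSpace d) : Set (RSpace d) :=
  {w | ∃ m ∈ M t x, w = x + h • f (t + h) z + h • m}

/-- One step of the parameterized semi-implicit Euler scheme:
`Φ(t,x;h) = {z | z ∈ x + h f(t+h, z) + h M(t, x)}`. -/
def eulerStep {d : ℕ} (f : ℝ → RSpace d → RSpace d) (M : ℝ → RSpace d → ConvexBody (RSpace d))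
    (t : ℝ) (x : RSpace d) (h : ℝ) : Set (RSpace d) :=
  {z | z ∈ stepSet f M t x h z}

/-- The domain `D` of all `(t,x,h)` with `t ∈ [0,T]`, `x ∈ ℝ^d`, `h ≥ 0`, such that `t + h`
is still a time in `[0,T]` (where `f` and `lf` are defined) and `lf(t+h) h < 1`. -/
def stepDomain (d : ℕ) (T : ℝ) (lf : ℝ → ℝ) : Set (ℝ × RSpace d × ℝ) :=
  {p | p.1 ∈ Set.Icc 0 T ∧ 0 ≤ p.2.2 ∧ p.1 + p.2.2 ∈ Set.Icc 0 T ∧ lf (p.1 + p.2.2) * p.2.2 < 1}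

/-! For c = 1 - l_f(t+h)h > 0, the one-sided Lipschitz bound makes G(z) = z - h f(t+h,z) strongly
monotone with constant c, and Φ = G⁻¹(x + hM(t,x)). G is onto by Minty's theorem and expands
distances by at least c, whence nonemptiness, compactness and the diameter bound. If G(z) = x + hm,
then G(z) - G(y) = (x + h f(t+h,y) + hm) - y, so expansion gives both distance estimates, matching
points with the same m. Minty's theorem reduces by compactness to finitely many quadratic
inequalities, which are solved by maximizing a concave function on a simplex. -/

section Minty

variable {E : Type*} [NormedAddCommGroup E] [InnerProductSpace ℝ E]

/-- Quadratic inequalities `‖x‖² - 2⟪x, b i⟫ + c i ≤ 0` with a common quadratic part have a common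
solution as soon as every convex combination of them has one. -/
theorem exists_forall_quadratic_nonpos {ι : Type*} [Fintype ι] [Nonempty ι] (b : ι → E)
    (c : ι → ℝ)
    (H : ∀ w ∈ stdSimplex ℝ ι, ∑ i, w i * c i ≤ ‖∑ i, w i • b i‖ ^ 2) :
    ∃ x : E, ∀ i, ‖x‖ ^ 2 - 2 * inner ℝ x (b i) + c i ≤ 0 := by
  classical
  have hne : (stdSimplex ℝ ι).Nonempty :=
    ⟨_, single_mem_stdSimplex ℝ (Classical.arbitrary ι)⟩
  -- Lagrangian duality: this is the concave dual function, and the barycentre at its maximizer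
  -- solves the system.
  obtain ⟨w, hw, hmax⟩ := (isCompact_stdSimplex ℝ ι).exists_isMaxOn hne
    (f := fun w : ι → ℝ => ∑ i, w i * c i - ‖∑ i, w i • b i‖ ^ 2) (by fun_prop)
  have hwH := H w hw
  refine ⟨∑ i, w i • b i, fun j => ?_⟩
  set B := ∑ i, w i • b i with hB
  set C := ∑ i, w i * c i with hC
  -- First-order optimality: move from `w` towards vertex `j` by `s`, then divide by `s`.
  have key : ∀ s ∈ Set.Ioc (0 : ℝ) 1,
      ‖B‖ ^ 2 - 2 * inner ℝ B (b j) + c j - (C - ‖B‖ ^ 2) ≤ s * ‖b j - B‖ ^ 2 := by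
    rintro s ⟨hs0, hs1⟩
    have hmem : (1 - s) • w + s • (Pi.single j 1 : ι → ℝ) ∈ stdSimplex ℝ ι :=
      convex_stdSimplex ℝ ι hw (single_mem_stdSimplex ℝ j) (by linarith) hs0.le (by ring)
    have h1 := hmax hmem
    have e1 : ∑ i, ((1 - s) • w + s • (Pi.single j 1 : ι → ℝ)) i * c i = (1 - s) * C + s * c j := by
      simp [add_mul, Finset.sum_add_distrib, mul_assoc, Finset.mul_sum, hC, Pi.single_apply]
    have e2 : ∑ i, ((1 - s) • w + s • (Pi.single j 1 : ι → ℝ)) i • b i = B + s • (b j - B) := by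
      have : ∑ i, ((1 - s) • w + s • (Pi.single j 1 : ι → ℝ)) i • b i = (1 - s) • B + s • b j := by
        simp [add_smul, Finset.sum_add_distrib, mul_smul, Finset.smul_sum, hB, Pi.single_apply]
      rw [this]; module
    simp only [Set.mem_ofPred_eq, e1, e2, ← hB, ← hC] at h1
    have e3 : ‖B + s • (b j - B)‖ ^ 2
        = ‖B‖ ^ 2 + 2 * (s * (inner ℝ B (b j) - ‖B‖ ^ 2)) + s ^ 2 * ‖b j - B‖ ^ 2 := by
      rw [norm_add_sq_real, inner_smul_right, inner_sub_right, real_inner_self_eq_norm_sq,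
        norm_smul, mul_pow, Real.norm_eq_abs, sq_abs]
    rw [e3] at h1
    refine le_of_mul_le_mul_left ?_ hs0
    linarith
  have hlim : ‖B‖ ^ 2 - 2 * inner ℝ B (b j) + c j - (C - ‖B‖ ^ 2) ≤ 0 := by
    have ht : Filter.Tendsto (fun s : ℝ => s * ‖b j - B‖ ^ 2) (nhdsWithin 0 (Set.Ioi 0))
        (nhds 0) := by
      have : Continuous fun s : ℝ => s * ‖b j - B‖ ^ 2 := by fun_prop
      simpa using (this.tendsto 0).mono_left nhdsWithin_le_nhds
    exact ge_of_tendsto ht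
      (Filter.eventually_of_mem (Ioc_mem_nhdsGT one_pos) key)
  linarith

/-- Chebyshev's inequality for a monotone family of pairs of vectors. -/
theorem inner_sum_smul_le_of_monotone {ι : Type*} [Fintype ι] (u v : ι → E)
    (hmono : ∀ i j, 0 ≤ inner ℝ (v i - v j) (u i - u j)) {w : ι → ℝ} (hw : w ∈ stdSimplex ℝ ι) :
    inner ℝ (∑ i, w i • v i) (∑ i, w i • u i) ≤ ∑ i, w i * inner ℝ (v i) (u i) := by
  have h0 : 0 ≤ ∑ i, ∑ j, w i * w j * inner ℝ (v i - v j) (u i - u j) :=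
    Finset.sum_nonneg fun i _ => Finset.sum_nonneg fun j _ =>
      mul_nonneg (mul_nonneg (hw.1 i) (hw.1 j)) (hmono i j)
  have e1 : ∑ i, ∑ j, w i * w j * inner ℝ (v i) (u i) = ∑ i, w i * inner ℝ (v i) (u i) := by
    refine Finset.sum_congr rfl fun i _ => ?_
    rw [← Finset.sum_mul, ← Finset.mul_sum, hw.2, mul_one]
  have e2 : ∑ i, ∑ j, w i * w j * inner ℝ (v j) (u j) = ∑ i, w i * inner ℝ (v i) (u i) := by
    rw [Finset.sum_comm, ← e1]
    exact Finset.sum_congr rfl fun i _ => Finset.sum_congr rfl fun j _ => by ring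
  have e3 : ∑ i, ∑ j, w i * w j * inner ℝ (v i) (u j)
      = inner ℝ (∑ i, w i • v i) (∑ i, w i • u i) := by
    rw [sum_inner]
    refine Finset.sum_congr rfl fun i _ => ?_
    rw [real_inner_smul_left, inner_sum, Finset.mul_sum]
    refine Finset.sum_congr rfl fun j _ => ?_
    rw [real_inner_smul_right, mul_assoc]
  have e4 : ∑ i, ∑ j, w i * w j * inner ℝ (v j) (u i)
      = inner ℝ (∑ i, w i • v i) (∑ i, w i • u i) := by
    rw [Finset.sum_comm, ← e3]
    exact Finset.sum_congr rfl fun i _ => Finset.sum_congr rfl fun j _ => by ring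
  have e5 : ∑ i, ∑ j, w i * w j * inner ℝ (v i - v j) (u i - u j)
      = ∑ i, ∑ j, w i * w j * inner ℝ (v i) (u i) - ∑ i, ∑ j, w i * w j * inner ℝ (v i) (u j)
        - ∑ i, ∑ j, w i * w j * inner ℝ (v j) (u i)
        + ∑ i, ∑ j, w i * w j * inner ℝ (v j) (u j) := by
    simp only [← Finset.sum_sub_distrib, ← Finset.sum_add_distrib]
    refine Finset.sum_congr rfl fun i _ => Finset.sum_congr rfl fun j _ => ?_
    simp only [inner_sub_left, inner_sub_right]
    ring
  linarith

/-- A finite monotone family of pairs `(u i, v i)` is monotonically related to some `(x, -x)`. -/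
theorem exists_forall_inner_nonpos_of_monotone {ι : Type*} [Fintype ι] (u v : ι → E)
    (hmono : ∀ i j, 0 ≤ inner ℝ (v i - v j) (u i - u j)) :
    ∃ x : E, ∀ i, inner ℝ (v i + x) (x - u i) ≤ 0 := by
  cases isEmpty_or_nonempty ι
  · exact ⟨0, fun i => isEmptyElim i⟩
  -- ⟪v + x, x - u⟫ = ‖x‖² - 2⟪x, (u - v)/2⟫ - ⟪v, u⟫.
  obtain ⟨x, hx⟩ := exists_forall_quadratic_nonpos (fun i => (1 / 2 : ℝ) • (u i - v i))
    (fun i => -inner ℝ (v i) (u i)) (by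
      intro w hw
      have h1 := inner_sum_smul_le_of_monotone u v hmono hw
      set U := ∑ i, w i • u i with hU
      set V := ∑ i, w i • v i with hV
      have e1 : ∑ i, w i • (1 / 2 : ℝ) • (u i - v i) = (1 / 2 : ℝ) • (U - V) := by
        simp only [hU, hV, ← Finset.sum_sub_distrib, Finset.smul_sum]
        exact Finset.sum_congr rfl fun i _ => by module
      have e2 : ‖(1 / 2 : ℝ) • (U - V)‖ ^ 2 = ‖(1 / 2 : ℝ) • (U + V)‖ ^ 2 - inner ℝ V U := by
        simp only [norm_smul, mul_pow, norm_sub_sq_real, norm_add_sq_real, real_inner_comm U V]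
        norm_num
        ring
      rw [e1, e2]
      simp only [mul_neg, Finset.sum_neg_distrib]
      nlinarith [sq_nonneg ‖(1 / 2 : ℝ) • (U + V)‖])
  refine ⟨x, fun i => ?_⟩
  have h1 := hx i
  simp only [inner_smul_right, inner_sub_right] at h1
  simp only [inner_add_left, inner_sub_right, real_inner_self_eq_norm_sq]
  rw [real_inner_comm (v i) x] at h1
  linarith

/-- **Minty's theorem** for continuous monotone maps of a finite-dimensional space. -/
theorem exists_add_eq_zero_of_monotone [FiniteDimensional ℝ E] {A : E → E} (hA : Continuous A)
    (hmono : ∀ x y, 0 ≤ inner ℝ (A x - A y) (x - y)) : ∃ x, A x + x = 0 := by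
  have : ProperSpace E := FiniteDimensional.proper ℝ E
  let K : E → Set E := fun u => {x | inner ℝ (A u + x) (x - u) ≤ 0}
  have hclosed : ∀ u, IsClosed (K u) := fun u =>
    isClosed_le (by fun_prop) continuous_const
  have hbdd : K 0 ⊆ Metric.closedBall 0 ‖A 0‖ := by
    intro x hx
    rw [mem_closedBall_zero_iff]
    have h1 : inner ℝ (A 0) x + ‖x‖ ^ 2 ≤ 0 := by
      simpa [K, inner_add_left] using hx
    have h2 := neg_le_of_abs_le (abs_real_inner_le_norm (A 0) x)
    by_contra! h3
    nlinarith [norm_nonneg (A 0)]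
  have hcompact : IsCompact (K 0) := (isCompact_closedBall 0 ‖A 0‖).of_isClosed_subset (hclosed 0) hbdd
  -- Finite intersection property; 0 is added to each finite family because `K 0` is the compact
  -- set.
  obtain ⟨x, -, hx⟩ := hcompact.inter_iInter_nonempty K hclosed (fun s => by
    classical
    obtain ⟨x, hx⟩ := exists_forall_inner_nonpos_of_monotone
      (fun i : ↥(insert 0 s) => (i : E)) (fun i => A i) (fun i j => hmono i j)
    exact ⟨x, hx ⟨0, Finset.mem_insert_self 0 s⟩, Set.mem_iInter₂.2 fun i hi =>
      hx ⟨i, Finset.mem_insert_of_mem hi⟩⟩)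
  rw [Set.mem_iInter] at hx
  refine ⟨x, ?_⟩
  -- Minty's trick: test with u = x - s(A x + x) and let s → 0.
  have key : ∀ s : ℝ, 0 < s → inner ℝ (A (x - s • (A x + x)) + x) (A x + x) ≤ 0 := by
    intro s hs
    have h1 : inner ℝ (A (x - s • (A x + x)) + x) (x - (x - s • (A x + x))) ≤ 0 := hx _
    rw [sub_sub_cancel, inner_smul_right] at h1
    exact nonpos_of_mul_nonpos_right h1 hs
  have hcont : Continuous fun s : ℝ => inner ℝ (A (x - s • (A x + x)) + x) (A x + x) := by
    fun_prop
  have h2 : inner ℝ (A x + x) (A x + x) ≤ 0 := by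
    have ht := (hcont.tendsto 0).mono_left (nhdsWithin_le_nhds (s := Set.Ioi 0))
    simp only [zero_smul, sub_zero] at ht
    exact le_of_tendsto ht (Filter.eventually_of_mem self_mem_nhdsWithin fun s hs => key s hs)
  rw [real_inner_self_eq_norm_sq] at h2
  exact norm_eq_zero.1 (pow_eq_zero_iff two_ne_zero |>.1 (h2.antisymm (sq_nonneg _)))

/-- A continuous strongly monotone map of a finite-dimensional space is surjective. -/
theorem surjective_of_strongly_monotone [FiniteDimensional ℝ E] {G : E → E} (hG : Continuous G)
    {c : ℝ} (hc : 0 < c) (hmono : ∀ x y, c * ‖x - y‖ ^ 2 ≤ inner ℝ (G x - G y) (x - y)) :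
    Function.Surjective G := by
  intro p
  -- Subtracting the identity uses up the strong monotonicity; A x + x = 0 then reads G x = p.
  obtain ⟨x, hx⟩ := exists_add_eq_zero_of_monotone (A := fun z => c⁻¹ • (G z - p) - z)
    (by fun_prop) (fun x y => by
      have e : c⁻¹ • (G x - p) - x - (c⁻¹ • (G y - p) - y) = c⁻¹ • (G x - G y) - (x - y) := by
        module
      rw [e, inner_sub_left, real_inner_smul_left, real_inner_self_eq_norm_sq, sub_nonneg,
        le_inv_mul_iff₀ hc]
      exact hmono x y)
  refine ⟨x, ?_⟩
  simpa [hc.ne', sub_eq_zero] using hx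

/-- A strongly monotone map expands distances. -/
theorem norm_sub_le_of_strongly_monotone {G : E → E} {c : ℝ} (hc : 0 < c)
    (hmono : ∀ x y, c * ‖x - y‖ ^ 2 ≤ inner ℝ (G x - G y) (x - y)) (x y : E) :
    ‖x - y‖ ≤ 1 / c * ‖G x - G y‖ := by
  rw [one_div, le_inv_mul_iff₀ hc]
  rcases (norm_nonneg (x - y)).eq_or_lt with h0 | h0
  · rw [← h0, mul_zero]; exact norm_nonneg _
  · have h1 := (hmono x y).trans (real_inner_le_norm _ _)
    refine le_of_mul_le_mul_right ?_ h0
    linarith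

end Minty

theorem osDist_singleton_left {d : ℕ} (y : RSpace d) (B : Set (RSpace d)) :
    osDist {y} B = Metric.infDist y B := by
  simp [osDist]

theorem isCompact_stepSet {d : ℕ} (f : ℝ → RSpace d → RSpace d)
    (M : ℝ → RSpace d → ConvexBody (RSpace d)) (t : ℝ) (x : RSpace d) (h : ℝ) (z : RSpace d) :
    IsCompact (stepSet f M t x h z) := by
  have e : stepSet f M t x h z
      = (fun m => x + h • f (t + h) z + h • m) '' (M t x : Set (RSpace d)) := by
    ext w
    exact ⟨fun ⟨m, hm, hw⟩ => ⟨m, hm, hw.symm⟩, fun ⟨m, hm, hw⟩ => ⟨m, hm, hw.symm⟩⟩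
  rw [e]
  exact (M t x).isCompact.image (by fun_prop)

theorem stepSet_nonempty {d : ℕ} (f : ℝ → RSpace d → RSpace d)
    (M : ℝ → RSpace d → ConvexBody (RSpace d)) (t : ℝ) (x : RSpace d) (h : ℝ) (z : RSpace d) :
    (stepSet f M t x h z).Nonempty :=
  (M t x).nonempty.imp' _ fun m hm => ⟨m, hm, rfl⟩

/-- Moving the implicit term to the left turns Φ into a preimage under G. -/
theorem mem_eulerStep_iff {d : ℕ} {f : ℝ → RSpace d → RSpace d}
    {M : ℝ → RSpace d → ConvexBody (RSpace d)} {t : ℝ} {x : RSpace d} {h : ℝ} {z : RSpace d} :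
    z ∈ eulerStep f M t x h ↔ ∃ m ∈ M t x, z - h • f (t + h) z = x + h • m := by
  refine exists_congr fun m => and_congr_right fun _ => ?_
  rw [sub_eq_iff_eq_add, add_right_comm]

theorem IsOSL.strongly_monotone_sub_smul {d : ℕ} {l : ℝ} {g : RSpace d → RSpace d}
    (hg : IsOSL l g) {h : ℝ} (hh : 0 ≤ h) (x y : RSpace d) :
    (1 - l * h) * ‖x - y‖ ^ 2 ≤ inner ℝ ((x - h • g x) - (y - h • g y)) (x - y) := by
  have e : (x - h • g x) - (y - h • g y) = (x - y) - h • (g x - g y) := by module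
  rw [e, inner_sub_left, real_inner_smul_left, real_inner_self_eq_norm_sq]
  linarith [mul_le_mul_of_nonneg_left (hg x y) hh]

theorem theorem7 (d : ℕ) (T : ℝ) (f : ℝ → RSpace d → RSpace d) (lf : ℝ → ℝ)
    (M : ℝ → RSpace d → ConvexBody (RSpace d))
    (hf : SinglePart T f lf) (hM : MultiPart T M)
    (t : ℝ) (x : RSpace d) (h : ℝ) (hD : (t, x, h) ∈ stepDomain d T lf) :
    (eulerStep f M t x h).Nonempty ∧
    IsCompact (eulerStep f M t x h) ∧
    Metric.diam (eulerStep f M t x h)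
      ≤ h / (1 - lf (t + h) * h) * Metric.diam (M t x : Set (RSpace d)) ∧
    ∀ y : RSpace d,
      osDist {y} (eulerStep f M t x h)
        ≤ 1 / (1 - lf (t + h) * h) * osDist {y} (stepSet f M t x h y) ∧
      osDist (eulerStep f M t x h) {y}
        ≤ 1 / (1 - lf (t + h) * h) * osDist (stepSet f M t x h y) {y} := by
  obtain ⟨-, hh, hth, hlt⟩ := hD
  simp only at hh hth hlt
  have hc : 0 < 1 - lf (t + h) * h := by linarith
  have hcont : Continuous (f (t + h)) :=
    hf.continuousOn.comp_continuous (f := fun z => (t + h, z)) (by fun_prop)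
      fun z => ⟨hth, Set.mem_univ z⟩
  have hmono := (hf.isOSL _ hth).strongly_monotone_sub_smul hh
  have hGc : Continuous fun z => z - h • f (t + h) z := by fun_prop
  have hsurj := surjective_of_strongly_monotone hGc hc hmono
  have hexp := norm_sub_le_of_strongly_monotone hc hmono
  set c := 1 - lf (t + h) * h
  have hdiam : ∀ z ∈ eulerStep f M t x h, ∀ z' ∈ eulerStep f M t x h,
      dist z z' ≤ h / c * Metric.diam (M t x : Set (RSpace d)) := by
    intro z hz z' hz'
    obtain ⟨m, hm, e⟩ := mem_eulerStep_iff.1 hz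
    obtain ⟨m', hm', e'⟩ := mem_eulerStep_iff.1 hz'
    have h1 := hexp z z'
    rw [e, e', add_sub_add_left_eq_sub, ← smul_sub, norm_smul, Real.norm_of_nonneg hh,
      ← dist_eq_norm, ← dist_eq_norm, ← mul_assoc, one_div_mul_eq_div] at h1
    exact h1.trans (mul_le_mul_of_nonneg_left
      (Metric.dist_le_diam_of_mem (M t x).isCompact.isBounded hm hm') (by positivity))
  have hnorm : ∀ z y m, z - h • f (t + h) z = x + h • m →
      dist z y ≤ 1 / c * dist (x + h • f (t + h) y + h • m) y := by
    intro z y m e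
    have h1 := hexp z y
    have e1 : x + h • m - (y - h • f (t + h) y) = x + h • f (t + h) y + h • m - y := by abel
    rwa [e, e1, ← dist_eq_norm, ← dist_eq_norm] at h1
  have hclosed : IsClosed (eulerStep f M t x h) := by
    have e : eulerStep f M t x h = (fun z => z - h • f (t + h) z) ⁻¹'
        ((fun m => x + h • m) '' (M t x : Set (RSpace d))) := by
      ext z
      rw [mem_eulerStep_iff]
      exact ⟨fun ⟨m, hm, hz⟩ => ⟨m, hm, hz.symm⟩, fun ⟨m, hm, hz⟩ => ⟨m, hm, hz.symm⟩⟩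
    rw [e]
    exact ((M t x).isCompact.image (by fun_prop)).isClosed.preimage hGc
  refine ⟨?_, Metric.isCompact_of_isClosed_isBounded hclosed
    (Metric.isBounded_iff.2 ⟨_, fun z hz z' hz' => hdiam z hz z' hz'⟩),
    Metric.diam_le_of_forall_dist_le (mul_nonneg (by positivity) Metric.diam_nonneg) hdiam,
    fun y => ⟨?_, ?_⟩⟩
  · obtain ⟨m, hm⟩ := (M t x).nonempty
    obtain ⟨z, hz⟩ := hsurj (x + h • m)
    exact ⟨z, mem_eulerStep_iff.2 ⟨m, hm, hz⟩⟩
  · rw [osDist_singleton_left, osDist_singleton_left]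
    obtain ⟨w, ⟨m, hm, rfl⟩, hw⟩ :=
      (isCompact_stepSet f M t x h y).exists_infDist_eq_dist (stepSet_nonempty f M t x h y) y
    obtain ⟨z, hz⟩ := hsurj (x + h • m)
    rw [hw, dist_comm]
    refine (Metric.infDist_le_dist_of_mem (mem_eulerStep_iff.2 ⟨m, hm, hz⟩)).trans ?_
    rw [dist_comm]
    exact hnorm z y m hz
  -- A real supremum defaults to 0 when unbounded, so `le_ciSup` needs this bound.
  · have hbdd : BddAbove (Set.range fun a : stepSet f M t x h y =>
        Metric.infDist (a : RSpace d) {y}) := by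
      have := (isCompact_stepSet f M t x h y).bddAbove_image
        (Metric.continuous_infDist_pt ({y} : Set (RSpace d))).continuousOn
      rwa [Set.image_eq_range] at this
    refine Real.iSup_le (fun ⟨z, hz⟩ => ?_) (mul_nonneg (by positivity)
      (Real.iSup_nonneg fun _ => Metric.infDist_nonneg))
    obtain ⟨m, hm, e⟩ := mem_eulerStep_iff.1 hz
    have h1 := le_ciSup hbdd ⟨x + h • f (t + h) y + h • m, m, hm, rfl⟩
    rw [Metric.infDist_singleton] at h1 ⊢
    exact (hnorm z y m e).trans (mul_le_mul_of_nonneg_left h1 (by positivity))
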